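/- Let $t>0$ and $K>0$. There is a constant $c=c(t,K)>0$ such that the following holds for all positive integers $n,N$, all integers $1\le r\le n$, all points $x_1,\dots,x_N\in\mathbb{R}^n$, all $\sigma>0$ and all $0<\epsilon<1$. Put $C=\max_{i,j}\frac{\|x_i-x_j\|_2^2}{2\sigma}$, assume $0<C\le K$, and let \[\delta=\frac{\epsilon}{4\max_{i,j}\left\{\frac{\|x_i-x_j\|_2^2}{2\sigma}\right\}}.\] Let $\Phi$ be a random $m\times n$ matrix with independent $\mathcal N(0,1)$ entries, where \[m\ \ge\ c\,\frac{r}{\epsilon^2}\,L,\qquad L=\max\left\{1,\log\frac{n}{\epsilon^2 r}\right\}.\] Then, with probability at least $1-e^{-t\,r\,L}$ (in particular at least $1-e^{-t}$), the matrix $\frac{1}{\sqrt m}\Phi$ satisfies the restricted isometry property with parameters $(r,\delta)$, that is, \[(1-\delta)\|v\|_2\le\left\|\tfrac{1}{\sqrt m}\Phi v\right\|_2\le(1+\delta)\|v\|_2\] for all $v\in\mathbb{R}^n$ with at most $r$ nonzero coordinates. -/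

import Mathlib

open MeasureTheory ProbabilityTheory
open scoped Matrix

/-- A vector is `r`-sparse if it has at most `r` nonzero coordinates. -/
def IsSparse {n : ℕ} (r : ℕ) (v : EuclideanSpace ℝ (Fin n)) : Prop :=
  {j : Fin n | v j ≠ 0}.ncard ≤ r

/-- The restricted isometry property with parameters `(r, δ)`:
`(1 - δ) ‖v‖₂ ≤ ‖A v‖₂ ≤ (1 + δ) ‖v‖₂` for all `r`-sparse `v` (Euclidean norms). -/
def RestrictedIsometry {m n : ℕ} (A : Matrix (Fin m) (Fin n) ℝ) (r : ℕ) (δ : ℝ) : Prop :=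
  ∀ v : EuclideanSpace ℝ (Fin n), IsSparse r v →
    (1 - δ) * ‖v‖ ≤ ‖WithLp.toLp 2 (A *ᵥ v.ofLp)‖ ∧
      ‖WithLp.toLp 2 (A *ᵥ v.ofLp)‖ ≤ (1 + δ) * ‖v‖

/-- A random `m × n` matrix is Gaussian if its entries are independent, each with the standard
normal law. -/
def IsGaussianMatrix {Ω : Type*} [MeasurableSpace Ω] {m n : ℕ}
    (Φ : Ω → Matrix (Fin m) (Fin n) ℝ) (P : Measure Ω) : Prop :=
  (∀ i j, HasLaw (fun ω => Φ ω i j) (gaussianReal 0 1) P) ∧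
    iIndepFun (fun (p : Fin m × Fin n) (ω : Ω) => Φ ω p.1 p.2) P

/-- The number `max_{i,j} ‖x i - x j‖₂² / (2 σ)` of a finite family of points
(a supremum over a finite set; it is `0` when there are no points). -/
noncomputable def maxScaledSqDist {N n : ℕ} (x : Fin N → EuclideanSpace ℝ (Fin n)) (σ : ℝ) : ℝ :=
  ⨆ p : Fin N × Fin N, ‖x p.1 - x p.2‖ ^ 2 / (2 * σ)

/-!
Only the distortion `δ₀ = κ ε` with `κ = min (1 / (4 K)) 1` matters, since `δ₀ ≤ min δ 1` and the
restricted isometry property is monotone in `δ`.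

The proof is the classical one by nets. The unit sphere of each of the `n.choose r` coordinate
subspaces of dimension at most `r` has a `1/2`-net of at most `5 ^ r` points (`exists_half_net`).
If `A` preserves the squared norms of all sums and differences of net points up to the factor
`1 ± δ₀ / 4`, then by polarization the form `⟪A x, A y⟫ - ⟪x, y⟫` is at most `δ₀ / 4` on pairs of
net points, hence has norm at most `δ₀` on the subspace (`abs_sq_norm_sub_le_of_half_net`). So the
property is decided by at most `n.choose r * (2 * 25 ^ r)` vectors fixed in advance
(`exists_testSet`).

For a fixed unit vector `u` the coordinates of `Φ u` are independent standard Gaussians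
(`IsGaussianMatrix.mulVec_of_norm_eq_one`), so `‖Φ u‖²` has a `χ²` law, and Chernoff's bound gives
a failure probability of at most `2 exp (-m η² / 16)` at distortion `η` of the squared norm
(`measureReal_abs_sum_sq_sub_one_ge_le`). The union bound over the test set, with
`n.choose r ≤ (e n / r) ^ r` and `n / r ≤ n / (ε² r) ≤ exp L`, costs `exp (7 r L)`, which
`m η² / 16 ≥ (t + 7) r L` absorbs.
-/

/-! ### Nets and a finite test set for the restricted isometry property -/

/-- A maximal `1/2`-separated subset of the unit sphere is a `1/2`-net; doubled, it is a
`1`-separated set in the ball of radius `2`, so that Besicovitch's volume bound applies. -/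
theorem exists_half_net (E : Type*) [NormedAddCommGroup E] [NormedSpace ℝ E]
    [FiniteDimensional ℝ E] :
    ∃ T : Finset E, T.card ≤ 5 ^ Module.finrank ℝ E ∧ (∀ y ∈ T, ‖y‖ = 1) ∧
      ∀ x : E, ‖x‖ = 1 → ∃ y ∈ T, ‖x - y‖ ≤ 1 / 2 := by
  classical
  have hbound : ∀ T : Finset E, (∀ y ∈ T, ‖y‖ = 1) →
      (∀ y ∈ T, ∀ z ∈ T, y ≠ z → 1 / 2 < ‖y - z‖) → T.card ≤ 5 ^ Module.finrank ℝ E := by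
    intro T h1 h2
    have hinj : Function.Injective fun y : E => (2 : ℝ) • y :=
      smul_right_injective E two_ne_zero
    rw [← Finset.card_image_of_injective T hinj]
    apply Besicovitch.card_le_of_separated
    · simp only [Finset.mem_image]
      rintro _ ⟨y, hy, rfl⟩
      simp [norm_smul, h1 y hy]
    · simp only [Finset.mem_image]
      rintro _ ⟨y, hy, rfl⟩ _ ⟨z, hz, rfl⟩ hne
      have := h2 y hy z hz (fun h => hne (by rw [h]))
      rw [← smul_sub, norm_smul, Real.norm_two]
      linarith
  let p : ℕ → Prop := fun k => ∃ T : Finset E, T.card = k ∧ (∀ y ∈ T, ‖y‖ = 1) ∧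
    ∀ y ∈ T, ∀ z ∈ T, y ≠ z → 1 / 2 < ‖y - z‖
  have hp0 : p 0 := ⟨∅, by simp⟩
  obtain ⟨T, hcard, h1, h2⟩ : p (Nat.findGreatest p (5 ^ Module.finrank ℝ E)) :=
    Nat.findGreatest_spec (Nat.zero_le _) hp0
  refine ⟨T, hbound T h1 h2, h1, fun x hx => ?_⟩
  by_contra! hfar
  have hxT : x ∉ T := fun h => by
    have := hfar x h
    norm_num at this
  have h1' : ∀ y ∈ insert x T, ‖y‖ = 1 := by
    simpa [hx] using h1
  have h2' : ∀ y ∈ insert x T, ∀ z ∈ insert x T, y ≠ z → 1 / 2 < ‖y - z‖ := by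
    intro y hy z hz hyz
    rw [Finset.mem_insert] at hy hz
    rcases hy with rfl | hy <;> rcases hz with rfl | hz
    · exact absurd rfl hyz
    · exact hfar z hz
    · rw [norm_sub_rev]
      exact hfar y hy
    · exact h2 y hy z hz hyz
  have := Nat.le_findGreatest (P := p) (hbound _ h1' h2') ⟨insert x T, rfl, h1', h2'⟩
  rw [Finset.card_insert_of_notMem hxT] at this
  omega

/-- Comparing `f x` with `f y` for the nearest net point `y` gives `‖f‖ ≤ a + ‖f‖ / 2`. -/
theorem opNorm_le_two_mul_of_half_net {E F : Type*} [NormedAddCommGroup E] [NormedSpace ℝ E]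
    [NormedAddCommGroup F] [NormedSpace ℝ F] (f : E →L[ℝ] F) {T : Finset E}
    (hT : ∀ x : E, ‖x‖ = 1 → ∃ y ∈ T, ‖x - y‖ ≤ 1 / 2) {a : ℝ} (ha : 0 ≤ a)
    (hf : ∀ y ∈ T, ‖f y‖ ≤ a) : ‖f‖ ≤ 2 * a := by
  have h : ‖f‖ ≤ a + ‖f‖ * (1 / 2) := by
    refine f.opNorm_le_of_unit_norm (by positivity) fun x hx => ?_
    obtain ⟨y, hy, hxy⟩ := hT x hx
    calc ‖f x‖ = ‖f y + f (x - y)‖ := by rw [map_sub, add_sub_cancel]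
      _ ≤ ‖f y‖ + ‖f (x - y)‖ := norm_add_le _ _
      _ ≤ a + ‖f‖ * (1 / 2) := by
        gcongr
        · exact hf y hy
        · exact (f.le_opNorm _).trans (by gcongr)
  linarith

/-- Almost isometry on the sums and differences of net points extends to the whole space. By
polarization the bilinear form `⟪f x, f y⟫ - ⟪x, y⟫` is at most `η` on pairs of net points;
passing from the net to the sphere costs a factor `2` in each variable. A `1/2`-net would be too
coarse to control the quadratic form directly, hence the detour through the bilinear form. -/
theorem abs_sq_norm_sub_le_of_half_net {E F : Type*} [NormedAddCommGroup E]
    [InnerProductSpace ℝ E] [NormedAddCommGroup F] [InnerProductSpace ℝ F] (f : E →L[ℝ] F)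
    {T : Finset E} (hT1 : ∀ y ∈ T, ‖y‖ = 1)
    (hT : ∀ x : E, ‖x‖ = 1 → ∃ y ∈ T, ‖x - y‖ ≤ 1 / 2) {η : ℝ} (hη : 0 ≤ η)
    (hadd : ∀ x ∈ T, ∀ y ∈ T, |‖f (x + y)‖ ^ 2 - ‖x + y‖ ^ 2| ≤ η * ‖x + y‖ ^ 2)
    (hsub : ∀ x ∈ T, ∀ y ∈ T, |‖f (x - y)‖ ^ 2 - ‖x - y‖ ^ 2| ≤ η * ‖x - y‖ ^ 2) (x : E) :
    |‖f x‖ ^ 2 - ‖x‖ ^ 2| ≤ 4 * η * ‖x‖ ^ 2 := by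
  let B : E →L[ℝ] E →L[ℝ] ℝ := (innerSL ℝ (E := F)).bilinearComp f f - innerSL ℝ (E := E)
  have hB : ∀ x y, B x y = inner ℝ (f x) (f y) - inner ℝ x y := fun x y => rfl
  have hpt : ∀ x ∈ T, ∀ y ∈ T, ‖B x y‖ ≤ η := by
    intro x hx y hy
    have h1 := abs_le.1 (hadd x hx y hy)
    have h2 := abs_le.1 (hsub x hx y hy)
    have e1 := norm_add_sq_real (f x) (f y)
    have e2 := norm_sub_sq_real (f x) (f y)
    have e3 := norm_add_sq_real x y
    have e4 := norm_sub_sq_real x y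
    rw [hT1 x hx, hT1 y hy] at e3 e4
    rw [map_add] at h1
    rw [map_sub] at h2
    rw [hB, Real.norm_eq_abs, abs_le]
    constructor <;> nlinarith
  have hB4 : ‖B‖ ≤ 2 * (2 * η) :=
    opNorm_le_two_mul_of_half_net B hT (by positivity) fun x hx =>
      opNorm_le_two_mul_of_half_net (B x) hT hη (hpt x hx)
  have h := B.le_opNorm₂ x x
  rw [hB, real_inner_self_eq_norm_sq, real_inner_self_eq_norm_sq, Real.norm_eq_abs] at h
  calc _ ≤ ‖B‖ * ‖x‖ * ‖x‖ := h
    _ ≤ 2 * (2 * η) * ‖x‖ * ‖x‖ := by gcongr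
    _ = 4 * η * ‖x‖ ^ 2 := by ring

/-- Passing from squared norms to norms loses nothing, as `(1 - δ)² ≤ 1 - δ` for `δ ∈ [0, 1]` and
`1 + δ ≤ (1 + δ)²`. -/
theorem restrictedIsometry_of_abs_sq_sub_le {m n r : ℕ} {A : Matrix (Fin m) (Fin n) ℝ} {δ : ℝ}
    (hδ0 : 0 ≤ δ) (hδ1 : δ ≤ 1)
    (h : ∀ v : EuclideanSpace ℝ (Fin n), IsSparse r v →
      |‖A.toEuclideanLin v‖ ^ 2 - ‖v‖ ^ 2| ≤ δ * ‖v‖ ^ 2) :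
    RestrictedIsometry A r δ := by
  intro v hv
  have h' := abs_le.1 (h v hv)
  change (1 - δ) * ‖v‖ ≤ ‖A.toEuclideanLin v‖ ∧ ‖A.toEuclideanLin v‖ ≤ (1 + δ) * ‖v‖
  have hv2 := sq_nonneg ‖v‖
  constructor
  · refine (sq_le_sq₀ (mul_nonneg (sub_nonneg.2 hδ1) (norm_nonneg _)) (norm_nonneg _)).1 ?_
    nlinarith [mul_nonneg (mul_nonneg hδ0 (sub_nonneg.2 hδ1)) hv2]
  · refine (sq_le_sq₀ (norm_nonneg _) (by positivity)).1 ?_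
    nlinarith [mul_nonneg (sq_nonneg δ) hv2, mul_nonneg hδ0 hv2]

theorem RestrictedIsometry.mono {m n r : ℕ} {A : Matrix (Fin m) (Fin n) ℝ} {δ δ' : ℝ}
    (h : RestrictedIsometry A r δ) (hδ : δ ≤ δ') : RestrictedIsometry A r δ' := fun v hv =>
  ⟨(by gcongr : (1 - δ') * ‖v‖ ≤ (1 - δ) * ‖v‖).trans (h v hv).1,
    (h v hv).2.trans (by gcongr)⟩

/-- The subspace of `ℝⁿ` spanned by the standard basis vectors with index in `S`, that is, of the
vectors supported in `S`. -/
noncomputable def coordSubspace {n : ℕ} (S : Finset (Fin n)) :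
    Submodule ℝ (EuclideanSpace ℝ (Fin n)) :=
  Submodule.span ℝ ((fun i => EuclideanSpace.single i (1 : ℝ)) '' S)

theorem finrank_coordSubspace_le {n : ℕ} (S : Finset (Fin n)) :
    Module.finrank ℝ (coordSubspace S) ≤ S.card := by
  classical
  rw [coordSubspace, ← Finset.coe_image]
  exact (finrank_span_finset_le_card _).trans Finset.card_image_le

theorem mem_coordSubspace {n : ℕ} {S : Finset (Fin n)} {v : EuclideanSpace ℝ (Fin n)}
    (hv : ∀ j, v j ≠ 0 → j ∈ S) : v ∈ coordSubspace S := by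
  rw [← (EuclideanSpace.basisFun (Fin n) ℝ).sum_repr v]
  refine Submodule.sum_mem _ fun j _ => ?_
  by_cases hj : v j = 0
  · simp [hj]
  · refine Submodule.smul_mem _ _ (Submodule.subset_span ⟨j, hv j hj, ?_⟩)
    simp

theorem IsSparse.exists_mem_coordSubspace {n r : ℕ} (hrn : r ≤ n)
    {v : EuclideanSpace ℝ (Fin n)} (hv : IsSparse r v) :
    ∃ S ∈ Finset.powersetCard r (Finset.univ : Finset (Fin n)), v ∈ coordSubspace S := by
  classical
  have hcard : (Finset.univ.filter fun j => v j ≠ 0).card ≤ r := by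
    rw [← Set.ncard_coe_finset]
    simpa [IsSparse] using hv
  obtain ⟨S, hsub, hS⟩ := Finset.exists_superset_card_eq hcard (by simpa using hrn)
  exact ⟨S, Finset.mem_powersetCard.2 ⟨Finset.subset_univ _, hS⟩,
    mem_coordSubspace fun j hj => hsub (by simpa using hj)⟩

/-- A finite set, independent of the matrix, on which the restricted isometry property can be
tested: the sums and differences of pairs of points from `1/2`-nets of the unit spheres of the
`r`-dimensional coordinate subspaces. -/
theorem exists_testSet (n r : ℕ) (hrn : r ≤ n) :
    ∃ D : Finset (EuclideanSpace ℝ (Fin n)), D.card ≤ n.choose r * (2 * 25 ^ r) ∧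
      ∀ (m : ℕ) (A : Matrix (Fin m) (Fin n) ℝ) (η : ℝ), 0 ≤ η → 4 * η ≤ 1 →
        (∀ u ∈ D, |‖A.toEuclideanLin u‖ ^ 2 - ‖u‖ ^ 2| ≤ η * ‖u‖ ^ 2) →
        RestrictedIsometry A r (4 * η) := by
  classical
  choose T hTcard hT1 hT using fun S : Finset (Fin n) => exists_half_net (coordSubspace S)
  let D : Finset (EuclideanSpace ℝ (Fin n)) :=
    (Finset.powersetCard r Finset.univ).biUnion fun S =>
      ((T S ×ˢ T S).image fun p => (p.1 : EuclideanSpace ℝ (Fin n)) + p.2) ∪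
        (T S ×ˢ T S).image fun p => (p.1 : EuclideanSpace ℝ (Fin n)) - p.2
  refine ⟨D, ?_, fun m A η hη hη1 hD => ?_⟩
  · refine (Finset.card_biUnion_le_card_mul _ _ (2 * 25 ^ r) fun S hS => ?_).trans_eq (by simp)
    have hTr : (T S).card ≤ 5 ^ r := by
      refine (hTcard S).trans (Nat.pow_le_pow_right (by norm_num) ?_)
      exact (finrank_coordSubspace_le S).trans_eq (Finset.mem_powersetCard.1 hS).2
    have hTT : (T S ×ˢ T S).card ≤ 25 ^ r := by
      rw [Finset.card_product, show 25 = 5 * 5 by norm_num, mul_pow]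
      exact Nat.mul_le_mul hTr hTr
    calc _ ≤ _ := Finset.card_union_le _ _
      _ ≤ (T S ×ˢ T S).card + (T S ×ˢ T S).card :=
        add_le_add Finset.card_image_le Finset.card_image_le
      _ ≤ 2 * 25 ^ r := by omega
  · refine restrictedIsometry_of_abs_sq_sub_le (by positivity) hη1 fun v hv => ?_
    obtain ⟨S, hS, hvS⟩ := hv.exists_mem_coordSubspace hrn
    refine abs_sq_norm_sub_le_of_half_net
      (A.toEuclideanLin.toContinuousLinearMap.comp (coordSubspace S).subtypeL)
      (hT1 S) (hT S) hη ?_ ?_ ⟨v, hvS⟩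
    · intro x hx y hy
      exact hD _ (Finset.mem_biUnion.2 ⟨S, hS, Finset.mem_union_left _
        (Finset.mem_image.2 ⟨(x, y), Finset.mk_mem_product hx hy, rfl⟩)⟩)
    · intro x hx y hy
      exact hD _ (Finset.mem_biUnion.2 ⟨S, hS, Finset.mem_union_right _
        (Finset.mem_image.2 ⟨(x, y), Finset.mk_mem_product hx hy, rfl⟩)⟩)

/-! ### Concentration of the norm of a Gaussian image -/

/-- The moment generating function of a centred `χ²` variable with one degree of freedom. -/
theorem mgf_sq_sub_one {Ω : Type*} [MeasurableSpace Ω] {P : Measure Ω} {X : Ω → ℝ}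
    (hX : HasLaw X (gaussianReal 0 1) P) {s : ℝ} (hs : s < 1 / 2) :
    mgf (fun ω => X ω ^ 2 - 1) P s = Real.exp (-s) * (√(1 - 2 * s))⁻¹ := by
  have h1 : mgf (fun ω => X ω ^ 2 - 1) P s
      = ∫ x, Real.exp (s * (x ^ 2 - 1)) ∂(gaussianReal 0 1) :=
    hX.integral_comp (f := fun x => Real.exp (s * (x ^ 2 - 1)))
      (by fun_prop)
  rw [h1, integral_gaussianReal_eq_integral_smul one_ne_zero]
  have h2 : ∀ x : ℝ, gaussianPDFReal 0 1 x • Real.exp (s * (x ^ 2 - 1))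
      = (Real.exp (-s) * (√(2 * Real.pi))⁻¹) * Real.exp (-(1 / 2 - s) * x ^ 2) := by
    intro x
    simp only [gaussianPDFReal, NNReal.coe_one, mul_one, sub_zero, smul_eq_mul]
    rw [mul_assoc, ← Real.exp_add, mul_comm (Real.exp (-s)), mul_assoc, ← Real.exp_add]
    ring_nf
  simp_rw [h2]
  rw [integral_const_mul, integral_gaussian, mul_assoc, ← Real.sqrt_inv, ← Real.sqrt_inv,
    ← Real.sqrt_mul (by positivity)]
  congr 2
  have := Real.pi_pos
  have : (1 / 2 - s) ≠ 0 := by linarith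
  have : (1 - 2 * s) ≠ 0 := by linarith
  field_simp

theorem inv_sqrt_one_sub_two_mul_le {s : ℝ} (hs : s ≤ 1 / 4) :
    (√(1 - 2 * s))⁻¹ ≤ Real.exp (s + 4 * s ^ 2) := by
  have hy : 0 < 1 - 2 * s := by linarith
  rw [← Real.sqrt_inv, Real.sqrt_le_left (Real.exp_nonneg _), ← Real.exp_nat_mul]
  -- `y⁻¹ ≤ exp (y⁻¹ - 1)` with `y = 1 - 2 s`, and `y⁻¹ - 1 = 2 s + 4 s² / y` with `1 / y ≤ 2`.
  have h1 : (1 - 2 * s)⁻¹ - 1 ≤ 2 * s + 8 * s ^ 2 := by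
    rw [sub_le_iff_le_add, inv_le_iff_one_le_mul₀ hy]
    nlinarith [mul_nonneg (sq_nonneg s) (sub_nonneg.2 hs)]
  calc (1 - 2 * s)⁻¹ = ((1 - 2 * s)⁻¹ - 1) + 1 := by ring
    _ ≤ Real.exp ((1 - 2 * s)⁻¹ - 1) := Real.add_one_le_exp _
    _ ≤ _ := by
      apply Real.exp_le_exp.2
      push_cast
      linarith

theorem mgf_sq_sub_one_le {Ω : Type*} [MeasurableSpace Ω] {P : Measure Ω} {X : Ω → ℝ}
    (hX : HasLaw X (gaussianReal 0 1) P) {s : ℝ} (hs : s ≤ 1 / 4) :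
    mgf (fun ω => X ω ^ 2 - 1) P s ≤ Real.exp (4 * s ^ 2) := by
  rw [mgf_sq_sub_one hX (by linarith)]
  calc _ ≤ Real.exp (-s) * Real.exp (s + 4 * s ^ 2) := by
        gcongr
        exact inv_sqrt_one_sub_two_mul_le hs
    _ = _ := by rw [← Real.exp_add]; ring_nf

/-- The bound `exp (4 s²)` tensorizes; integrability is what Chernoff's inequality needs. -/
theorem mgf_sum_sq_sub_one {Ω : Type*} [MeasurableSpace Ω] {P : Measure Ω}
    {m : ℕ} {Y : Fin m → Ω → ℝ}
    (hY : ∀ i, HasLaw (Y i) (gaussianReal 0 1) P) (hind : iIndepFun Y P) {s : ℝ}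
    (hs : s ≤ 1 / 4) :
    Integrable (fun ω => Real.exp (s * (∑ i, fun ω => Y i ω ^ 2 - 1) ω)) P ∧
      mgf (∑ i, fun ω => Y i ω ^ 2 - 1) P s ≤ Real.exp (m * (4 * s ^ 2)) := by
  have hprod : mgf (∑ i, fun ω => Y i ω ^ 2 - 1) P s
      = ∏ i, mgf (fun ω => Y i ω ^ 2 - 1) P s :=
    (hind.comp (fun _ x => x ^ 2 - 1) fun _ => by fun_prop).mgf_sum₀
      (fun i => by
        have := (hY i).aemeasurable
        exact (this.pow_const 2).sub_const 1) Finset.univ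
  constructor
  -- A nonintegrable exponential would have the junk moment generating function `0`, whereas the
  -- product formula shows that it is positive.
  · by_contra h
    rw [mgf_undef h] at hprod
    refine (Finset.prod_pos fun i _ => ?_).ne hprod
    rw [mgf_sq_sub_one (hY i) (by linarith)]
    have : 0 < 1 - 2 * s := by linarith
    positivity
  · rw [hprod]
    calc _ ≤ ∏ _i : Fin m, Real.exp (4 * s ^ 2) :=
          Finset.prod_le_prod (fun _ _ => mgf_nonneg) fun i _ => mgf_sq_sub_one_le (hY i) hs
      _ = _ := by rw [Finset.prod_const, Finset.card_univ, Fintype.card_fin, Real.exp_nat_mul]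

/-- Concentration of the `χ²` distribution with `m` degrees of freedom, from Chernoff's bounds with
the parameters `± η / 8`. -/
theorem measureReal_abs_sum_sq_sub_one_ge_le {Ω : Type*} [MeasurableSpace Ω] {P : Measure Ω}
    [IsProbabilityMeasure P] {m : ℕ} {Y : Fin m → Ω → ℝ}
    (hY : ∀ i, HasLaw (Y i) (gaussianReal 0 1) P) (hind : iIndepFun Y P) {η : ℝ}
    (hη0 : 0 ≤ η) (hη1 : η ≤ 1) :
    P.real {ω | m * η ≤ |∑ i, (Y i ω ^ 2 - 1)|} ≤ 2 * Real.exp (-(m * η ^ 2 / 16)) := by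
  set Z : Ω → ℝ := ∑ i, fun ω => Y i ω ^ 2 - 1 with hZ
  have hZapp : ∀ ω, ∑ i, (Y i ω ^ 2 - 1) = Z ω := fun ω => by simp [hZ]
  simp_rw [hZapp]
  have hup : P.real {ω | m * η ≤ Z ω} ≤ Real.exp (-(m * η ^ 2 / 16)) := by
    obtain ⟨hint, hm⟩ := mgf_sum_sq_sub_one hY hind (s := η / 8) (by linarith)
    refine (measure_ge_le_exp_mul_mgf (m * η) (by positivity) hint).trans ?_
    refine (mul_le_mul_of_nonneg_left hm (Real.exp_nonneg _)).trans_eq ?_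
    rw [← Real.exp_add]
    ring_nf
  have hlow : P.real {ω | Z ω ≤ -(m * η)} ≤ Real.exp (-(m * η ^ 2 / 16)) := by
    obtain ⟨hint, hm⟩ := mgf_sum_sq_sub_one hY hind (s := -(η / 8)) (by linarith)
    refine (measure_le_le_exp_mul_mgf (-(m * η)) (by linarith) hint).trans ?_
    refine (mul_le_mul_of_nonneg_left hm (Real.exp_nonneg _)).trans_eq ?_
    rw [← Real.exp_add]
    ring_nf
  calc _ ≤ P.real ({ω | m * η ≤ Z ω} ∪ {ω | Z ω ≤ -(m * η)}) := by
        refine measureReal_mono fun ω hω => ?_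
        rcases le_abs.1 (show m * η ≤ |Z ω| from hω) with h | h
        · exact Or.inl h
        · exact Or.inr (show Z ω ≤ -(m * η) by linarith)
    _ ≤ _ := measureReal_union_le _ _
    _ ≤ _ := by linarith

/-- The coordinates of `Φ u` are jointly Gaussian, so that their independence and their law can be
read off from means and covariances. -/
theorem IsGaussianMatrix.mulVec_of_norm_eq_one {Ω : Type*} [MeasurableSpace Ω] {P : Measure Ω}
    [IsProbabilityMeasure P] {m n : ℕ} {Φ : Ω → Matrix (Fin m) (Fin n) ℝ}
    (hΦ : IsGaussianMatrix Φ P) {u : EuclideanSpace ℝ (Fin n)} (hu : ‖u‖ = 1) :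
    (∀ i, HasLaw (fun ω => (Φ ω *ᵥ u.ofLp) i) (gaussianReal 0 1) P) ∧
      iIndepFun (fun i ω => (Φ ω *ᵥ u.ofLp) i) P := by
  obtain ⟨hlaw, hind⟩ := hΦ
  have hent : ∀ i j, HasGaussianLaw (fun ω => Φ ω i j) P := fun i j => (hlaw i j).hasGaussianLaw
  have hL2 : ∀ i j, MemLp (fun ω => Φ ω i j) 2 P := fun i j => (hent i j).memLp_two
  have hvar : ∀ i j, Var[fun ω => Φ ω i j; P] = 1 := fun i j => by
    rw [(hlaw i j).variance_eq, variance_id_gaussianReal, NNReal.coe_one]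
  have hmean : ∀ i j, P[fun ω => Φ ω i j] = 0 := fun i j => by
    rw [(hlaw i j).integral_eq, integral_id_gaussianReal]
  have hjoint : HasGaussianLaw (fun ω (p : Fin m × Fin n) => Φ ω p.1 p.2) P :=
    hind.hasGaussianLaw fun p => hent p.1 p.2
  have hvec : HasGaussianLaw (fun ω i => (Φ ω *ᵥ u.ofLp) i) P := by
    let L : (Fin m × Fin n → ℝ) →L[ℝ] (Fin m → ℝ) :=
      ContinuousLinearMap.pi fun i => ∑ j, u j • ContinuousLinearMap.proj (i, j)
    have h := hjoint.map_fun L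
    convert! h using 3 with ω i
    simp [L, Matrix.mulVec, dotProduct, mul_comm]
  have hrow : ∀ i, (fun ω => (Φ ω *ᵥ u.ofLp) i) = fun ω => ∑ j, Φ ω i j * u j :=
    fun i => rfl
  have hcov : ∀ i i', cov[fun ω => (Φ ω *ᵥ u.ofLp) i, fun ω => (Φ ω *ᵥ u.ofLp) i'; P]
      = if i = i' then 1 else 0 := by
    intro i i'
    rw [hrow, hrow, covariance_fun_sum_fun_sum (fun j => (hL2 i j).mul_const _)
      (fun j => (hL2 i' j).mul_const _)]
    have hterm : ∀ j j', cov[fun ω => Φ ω i j * u j, fun ω => Φ ω i' j' * u j'; P]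
        = if i = i' ∧ j = j' then u j ^ 2 else 0 := by
      intro j j'
      rw [covariance_mul_const_left, covariance_mul_const_right]
      split_ifs with h
      · obtain ⟨rfl, rfl⟩ := h
        rw [covariance_self (hent i j).aemeasurable, hvar]
        ring
      · have hne : (i, j) ≠ (i', j') := fun h' => h (Prod.mk.inj h')
        rw [(hind.indepFun hne).covariance_eq_zero (hL2 i j) (hL2 i' j')]
        ring
    simp_rw [hterm]
    split_ifs with h
    · have hs : ∑ j, u j ^ 2 = 1 := by
        rw [← EuclideanSpace.real_norm_sq_eq, hu, one_pow]
      simp [h, hs]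
    · simp [h]
  refine ⟨fun i => ⟨(hvec.eval i).aemeasurable, ?_⟩,
    hvec.iIndepFun_of_covariance_eq_zero fun i j hij => by rw [hcov, if_neg hij]⟩
  have h0 : P[fun ω => (Φ ω *ᵥ u.ofLp) i] = 0 := by
    rw [hrow, integral_finsetSum _ fun j _ => ((hent i j).integrable.mul_const _)]
    simp [integral_mul_const, hmean]
  have h1 : Var[fun ω => (Φ ω *ᵥ u.ofLp) i; P] = 1 := by
    rw [← covariance_self (hvec.eval i).aemeasurable, hcov, if_pos rfl]
  rw [(hvec.eval i).map_eq_gaussianReal, h0, h1, Real.toNNReal_one]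

/-- A fixed vector is badly distorted with small probability. The strict inequality makes the bad
event empty for `u = 0`. -/
theorem IsGaussianMatrix.measureReal_abs_sq_norm_sub_gt_le {Ω : Type*} [MeasurableSpace Ω]
    {P : Measure Ω} [IsProbabilityMeasure P] {m n : ℕ} {Φ : Ω → Matrix (Fin m) (Fin n) ℝ}
    (hΦ : IsGaussianMatrix Φ P) (hm : 0 < m) {η : ℝ} (hη0 : 0 ≤ η) (hη1 : η ≤ 1)
    (u : EuclideanSpace ℝ (Fin n)) :
    P.real {ω | η * ‖u‖ ^ 2 <
        |‖((1 / √m) • Φ ω).toEuclideanLin u‖ ^ 2 - ‖u‖ ^ 2|}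
      ≤ 2 * Real.exp (-(m * η ^ 2 / 16)) := by
  rcases eq_or_ne u 0 with rfl | hu
  · simp
    positivity
  have hu0 : 0 < ‖u‖ := norm_pos_iff.2 hu
  have hm0 : (0 : ℝ) < m := by exact_mod_cast hm
  obtain ⟨w, hw1, huw⟩ : ∃ w : EuclideanSpace ℝ (Fin n), ‖w‖ = 1 ∧ u = ‖u‖ • w :=
    ⟨‖u‖⁻¹ • u, norm_smul_inv_norm (𝕜 := ℝ) hu, by rw [smul_inv_smul₀ hu0.ne']⟩
  obtain ⟨h1, h2⟩ := hΦ.mulVec_of_norm_eq_one hw1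
  refine (measureReal_mono fun ω hω => ?_).trans
    (measureReal_abs_sum_sq_sub_one_ge_le h1 h2 hη0 hη1)
  have hkey : ‖((1 / √m) • Φ ω).toEuclideanLin u‖ ^ 2 - ‖u‖ ^ 2
      = ‖u‖ ^ 2 / m * ∑ i, ((Φ ω *ᵥ w.ofLp) i ^ 2 - 1) := by
    have hn : ‖(Φ ω).toEuclideanLin w‖ ^ 2 = ∑ i, (Φ ω *ᵥ w.ofLp) i ^ 2 := by
      rw [EuclideanSpace.real_norm_sq_eq]
      rfl
    have hscale : ((1 / √m) • Φ ω).toEuclideanLin u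
        = ‖u‖ • (1 / √m) • (Φ ω).toEuclideanLin w := by
      conv_lhs => rw [huw]
      rw [map_smul, map_smul]
      rfl
    rw [hscale, norm_smul, norm_smul, mul_pow, mul_pow, hn]
    simp only [Finset.sum_sub_distrib, Finset.sum_const, Finset.card_univ, Fintype.card_fin,
      nsmul_eq_mul, norm_div, norm_one, Real.norm_eq_abs, sq_abs, div_pow,
      Real.sq_sqrt hm0.le]
    field_simp
  simp only [Set.mem_ofPred_eq] at hω ⊢
  rw [hkey, abs_mul, abs_of_pos (by positivity)] at hω
  have : ‖u‖ ^ 2 / m * (m * η) < ‖u‖ ^ 2 / m * |∑ i, ((Φ ω *ᵥ w.ofLp) i ^ 2 - 1)| := by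
    refine lt_of_eq_of_lt ?_ hω
    field_simp
  exact (lt_of_mul_lt_mul_left this (by positivity)).le

/-! ### The union bound -/

/-- The union bound over the test set. The event need not be measurable: only monotonicity and
subadditivity of the measure are used. -/
theorem IsGaussianMatrix.measureReal_not_restrictedIsometry_le {Ω : Type*} [MeasurableSpace Ω]
    {P : Measure Ω} [IsProbabilityMeasure P] {m n r : ℕ} {Φ : Ω → Matrix (Fin m) (Fin n) ℝ}
    (hΦ : IsGaussianMatrix Φ P) (hm : 0 < m) (hrn : r ≤ n) {η : ℝ} (hη0 : 0 ≤ η)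
    (hη1 : 4 * η ≤ 1) :
    P.real {ω | ¬ RestrictedIsometry ((1 / √m) • Φ ω) r (4 * η)}
      ≤ (n.choose r * (2 * 25 ^ r)) * (2 * Real.exp (-(m * η ^ 2 / 16))) := by
  obtain ⟨D, hDcard, hD⟩ := exists_testSet n r hrn
  set B : EuclideanSpace ℝ (Fin n) → Set Ω := fun u => {ω | η * ‖u‖ ^ 2 <
    |‖((1 / √m) • Φ ω).toEuclideanLin u‖ ^ 2 - ‖u‖ ^ 2|}
  have hsub : {ω | ¬ RestrictedIsometry ((1 / √m) • Φ ω) r (4 * η)} ⊆ ⋃ u ∈ D, B u := by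
    intro ω hω
    by_contra hcon
    refine hω (hD m _ η hη0 hη1 fun u hu => ?_)
    by_contra! hlt
    exact hcon (Set.mem_biUnion hu hlt)
  have hsum : ∑ u ∈ D, P.real (B u) ≤ D.card * (2 * Real.exp (-(m * η ^ 2 / 16))) := by
    rw [← nsmul_eq_mul]
    exact Finset.sum_le_card_nsmul _ _ _ fun u _ =>
      hΦ.measureReal_abs_sq_norm_sub_gt_le hm hη0 (by linarith) u
  have hD' : (D.card : ℝ) ≤ n.choose r * (2 * 25 ^ r) := by exact_mod_cast hDcard
  exact (measureReal_mono hsub (measure_ne_top _ _)).trans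
    ((measureReal_biUnion_finset_le _ _).trans
      (hsum.trans (mul_le_mul_of_nonneg_right hD' (by positivity))))

/-- A form of `n.choose r ≤ (e n / r) ^ r`. -/
theorem choose_le_exp_mul_add {n r : ℕ} (hr : 1 ≤ r) {l : ℝ} (hl : (n / r : ℝ) ≤ Real.exp l) :
    (n.choose r : ℝ) ≤ Real.exp (r * l + r) := by
  have hr0 : (0 : ℝ) < r := by exact_mod_cast hr
  calc (n.choose r : ℝ) ≤ (n : ℝ) ^ r / r.factorial := Nat.choose_le_pow_div r n
    _ = (n / r : ℝ) ^ r * ((r : ℝ) ^ r / r.factorial) := by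
      rw [div_pow]
      field_simp
    _ ≤ Real.exp l ^ r * Real.exp r := by
      gcongr
      exact Real.pow_div_factorial_le_exp _ hr0.le r
    _ = _ := by rw [← Real.exp_nat_mul, Real.exp_add]

theorem corollary3 (t : ℝ) (ht : 0 < t) (K : ℝ) (hK : 0 < K) :
    ∃ c : ℝ, 0 < c ∧
      ∀ (m n N r : ℕ) (x : Fin N → EuclideanSpace ℝ (Fin n)) (σ ε δ : ℝ)
        (Ω : Type*) [MeasurableSpace Ω] (P : Measure Ω) [IsProbabilityMeasure P]
        (Φ : Ω → Matrix (Fin m) (Fin n) ℝ),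
        1 ≤ r → r ≤ n → 0 < σ → 0 < ε → ε < 1 →
        0 < maxScaledSqDist x σ → maxScaledSqDist x σ ≤ K →
        δ = ε / (4 * maxScaledSqDist x σ) →
        IsGaussianMatrix Φ P →
        c * ((r / ε ^ 2) * max 1 (Real.log (n / (ε ^ 2 * r)))) ≤ m →
        1 - Real.exp (-t * (r * max 1 (Real.log (n / (ε ^ 2 * r)))))
          ≤ P.real {ω | RestrictedIsometry ((1 / Real.sqrt m) • Φ ω) r δ} := by
  -- `δ` may exceed `1`; the proof works with the smaller distortion `κ ε ≤ min δ 1`.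
  set κ : ℝ := min (1 / (4 * K)) 1
  have hκ0 : 0 < κ := lt_min (by positivity) one_pos
  have hκ1 : κ ≤ 1 := min_le_right _ _
  -- With `4 η = κ ε ≤ δ`, each test vector fails with probability at most
  -- `2 exp (-m κ² ε² / 256)`, while the number of test vectors, times this factor `2`, is at most
  -- `exp (7 r L)`.
  refine ⟨256 * (t + 7) / κ ^ 2, by positivity, ?_⟩
  intro m n N r x σ ε δ Ω _ P _ Φ hr hrn _ hε0 hε1 hC0 hCK hδ hΦ hm
  set L : ℝ := max 1 (Real.log (n / (ε ^ 2 * r)))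
  have hL1 : 1 ≤ L := le_max_left _ _
  have hr1 : (1 : ℝ) ≤ r := by exact_mod_cast hr
  have hr0 : (0 : ℝ) < r := by linarith
  have hn0 : (0 : ℝ) < n := by exact_mod_cast (by omega : 0 < n)
  have hm0 : 0 < m := by
    have : (0 : ℝ) < m := lt_of_lt_of_le (by positivity) hm
    exact_mod_cast this
  set η : ℝ := κ * ε / 4 with hη
  have hκε : κ * ε ≤ 1 := mul_le_one₀ hκ1 hε0.le hε1.le
  have hηδ : 4 * η ≤ δ := by
    calc 4 * η = κ * ε := by rw [hη]; ring
      _ ≤ 1 / (4 * maxScaledSqDist x σ) * ε := by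
        gcongr
        exact (min_le_left _ _).trans (by gcongr)
      _ = δ := by rw [hδ]; ring
  have hfail := hΦ.measureReal_not_restrictedIsometry_le hm0 hrn (η := η) (by positivity)
    (by rw [hη]; linarith)
  have hmη : (t + 7) * (r * L) ≤ m * η ^ 2 / 16 := by
    calc (t + 7) * (r * L)
        = 256 * (t + 7) / κ ^ 2 * (r / ε ^ 2 * L) * η ^ 2 / 16 := by
          rw [hη]
          field_simp
          norm_num
      _ ≤ m * η ^ 2 / 16 := by gcongr
  have hnr : (n / r : ℝ) ≤ Real.exp L := by
    calc (n / r : ℝ) ≤ n / (ε ^ 2 * r) := by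
          gcongr
          exact mul_le_of_le_one_left hr0.le (pow_le_one₀ hε0.le hε1.le)
      _ = Real.exp (Real.log (n / (ε ^ 2 * r))) := (Real.exp_log (by positivity)).symm
      _ ≤ Real.exp L := Real.exp_le_exp.2 (le_max_right _ _)
  have hconst : (4 : ℝ) * 25 ^ r ≤ Real.exp (r * 5) := by
    have h5 : (100 : ℝ) ≤ Real.exp 5 := by
      have := Real.exp_one_gt_d9
      calc (100 : ℝ) ≤ 2.7 ^ 5 := by norm_num
        _ ≤ Real.exp 1 ^ 5 := by gcongr; linarith
        _ = Real.exp 5 := by rw [← Real.exp_nat_mul]; norm_num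
    calc (4 : ℝ) * 25 ^ r ≤ 4 ^ r * 25 ^ r := by
          gcongr
          exact le_self_pow₀ (by norm_num) (by omega)
      _ = 100 ^ r := by rw [← mul_pow]; norm_num
      _ ≤ Real.exp 5 ^ r := by gcongr
      _ = Real.exp (r * 5) := (Real.exp_nat_mul _ _).symm
  have hbad : P.real {ω | ¬ RestrictedIsometry ((1 / √m) • Φ ω) r (4 * η)}
      ≤ Real.exp (-t * (r * L)) := by
    calc _ ≤ _ := hfail
      _ = n.choose r * (4 * 25 ^ r) * Real.exp (-(m * η ^ 2 / 16)) := by ring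
      _ ≤ Real.exp (r * L + r) * Real.exp (r * 5) * Real.exp (-((t + 7) * (r * L))) := by
        gcongr
        exact choose_le_exp_mul_add hr hnr
      _ = Real.exp (r * L + r + r * 5 + -((t + 7) * (r * L))) := by
        rw [Real.exp_add (r * L + r + r * 5), Real.exp_add (r * L + r)]
      _ ≤ _ := by
        apply Real.exp_le_exp.2
        nlinarith
  -- Subadditivity avoids any measurability of the event of restricted isometry.
  have hcover : 1 ≤ P.real {ω | RestrictedIsometry ((1 / √m) • Φ ω) r δ}
      + P.real {ω | ¬ RestrictedIsometry ((1 / √m) • Φ ω) r (4 * η)} := by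
    refine (probReal_univ (μ := P)).ge.trans (le_trans ?_ (measureReal_union_le _ _))
    refine measureReal_mono fun ω _ => ?_
    by_cases h : RestrictedIsometry ((1 / √m) • Φ ω) r (4 * η)
    · exact Or.inl (h.mono hηδ)
    · exact Or.inr h
  linarith
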